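/- Let $k$ be an algebraically closed field of characteristic $0$ and let $f\in k[x,y,z]$ be a homogeneous polynomial of degree $8$. For $A\in GL(3,k)$ let $f_A(v)=f(A^{-1}v)$. For a subgroup $G$ of $PGL(3,k)$, call $f$ $G$-invariant if for every $A\in GL(3,k)$ whose class lies in $G$ there is $\lambda\in k\setminus\{0\}$ with $f_A=\lambda f$. Call $f$ singular if $f$ and all its first partial derivatives vanish at some common point of the projective plane over $k$, and non-singular otherwise. Call $f$ and $g$ projectively equivalent if $f_A=\lambda g$ for some $A\in GL(3,k)$ and $\lambda\in k\setminus\{0\}$. (1) If $f$ is $G$-invariant for some cyclic subgroup $G$ of $PGL(3,k)$ of order $5$ or $11$, then $f$ is singular. (2) Let $G$ be a subgroup of $PGL(3,k)$ with $|G|=2^7$. If $f$ is non-singular and $G$-invariant, then $f$ is projectively equivalent to the Fermat octic $x^8+y^8+z^8$. -/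

import Mathlib

namespace PlaneCurve

open MvPolynomial
open scoped MatrixGroups

variable {k : Type*} [Field k]

/-- The transform `f_A (x) = f (A⁻¹ x)` of a ternary polynomial `f` under `A ∈ GL(3, k)`:
the variable `x_i` is replaced by the linear form `∑ j, (A⁻¹)_{ij} x_j`. -/
noncomputable def transform (A : GL (Fin 3) k) (f : MvPolynomial (Fin 3) k) :
    MvPolynomial (Fin 3) k :=
  aeval (fun i : Fin 3 => ∑ j : Fin 3, C ((A⁻¹ : GL (Fin 3) k).val i j) * X j) f

/-- `f` is invariant under a subgroup `G` of `PGL(3, k)`: every projectivity `(A)` in `G`, given by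
any matrix `A` representing it, maps `f` to a non-zero scalar multiple of `f`. -/
def IsInvariant (G : Subgroup PGL(3, k)) (f : MvPolynomial (Fin 3) k) : Prop :=
  ∀ A : GL (Fin 3) k, Matrix.ProjGenLinGroup.mk A ∈ G →
    ∃ c : k, c ≠ 0 ∧ transform A f = C c * f

/-- The projective plane curve `f = 0` has a singular point: a point of the projective plane, with
homogeneous coordinates `v`, at which `f` and all its first partial derivatives vanish. -/
def IsSingular (f : MvPolynomial (Fin 3) k) : Prop :=
  ∃ v : Fin 3 → k, v ≠ 0 ∧ eval v f = 0 ∧ ∀ i, eval v (pderiv i f) = 0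

/-- `f` and `g` are projectively equivalent: a projectivity of the plane carries `f` to `g`, up to
a non-zero scalar factor. -/
def ProjEquiv (f g : MvPolynomial (Fin 3) k) : Prop :=
  ∃ A : GL (Fin 3) k, ∃ c : k, c ≠ 0 ∧ transform A f = C c * g

/-- The Fermat form `x ^ n + y ^ n + z ^ n`. -/
noncomputable def fermat (k : Type*) [Field k] (n : ℕ) : MvPolynomial (Fin 3) k :=
  X 0 ^ n + X 1 ^ n + X 2 ^ n

end PlaneCurve

namespace PlaneCurve

open Matrix

open MvPolynomial
open scoped MatrixGroups

/-! ### Linear substitutions, singular points and coefficients. -/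

section Transform

variable {k : Type*} [Field k]

/-! A non-singular octic contains, for each `i`, a monomial `x_i ^ 7 * x_(j i)`, since otherwise a
vertex of the coordinate triangle would be singular. A diagonal symmetry with entries `r i` gives
all monomials of the form one weight, so `r i ^ 7 * r (j i)` does not depend on `i`. Iterating along
`j`, which satisfies `j^8 = j^2`, shows that the ratios of the `r i` have order dividing `7^8 - 7^2
= 2^4 * 3^2 * 7^2 * 19 * 43` (`pow_eq_pow_of_pow_mul_eq`). Elements of finite order in `PGL(3, k)`
are diagonalizable, and 5 and 11 are prime to this number, which gives (1).

For (2), a central involution of `G` lifts `G` to `GL(2, k)` (`exists_le_range_blockHom`), where a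
2-group has a diagonal subgroup of index at most 2 up to conjugacy. This yields a group `D` of at
least 64 pairs of units, of exponent dividing 16 by the weight bound. By counting, `D` contains both
sign changes of a single coordinate, which force `j = id`. The exponent then divides 8, so `D` is
large enough to contain elements of order 8 acting on one coordinate alone. Hence all exponents of
monomials are divisible by 8, and rescaling the coordinates gives the Fermat octic. -/

lemma transform_C_mul (A : GL (Fin 3) k) (c : k) (f : MvPolynomial (Fin 3) k) :
    transform A (C c * f) = C c * transform A f := by
  simp [transform]

lemma transform_mul (A B : GL (Fin 3) k) (f : MvPolynomial (Fin 3) k) :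
    transform (A * B) f = transform A (transform B f) := by
  simp only [transform, _root_.mul_inv_rev, Units.val_mul]
  generalize (A⁻¹ : GL (Fin 3) k).val = M
  generalize (B⁻¹ : GL (Fin 3) k).val = N
  rw [← AlgHom.comp_apply, comp_aeval]
  refine congrArg (fun g => aeval g f) (funext fun i => ?_)
  simp only [map_sum, map_mul, aeval_X, algHom_C, Matrix.mul_apply, Finset.sum_mul,
    Finset.mul_sum, MvPolynomial.algebraMap_eq]
  rw [Finset.sum_comm]
  simp only [mul_assoc]

lemma IsHomogeneous.transform {f : MvPolynomial (Fin 3) k} {n : ℕ} (hf : f.IsHomogeneous n)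
    (A : GL (Fin 3) k) : (transform A f).IsHomogeneous n := by
  have := hf.aeval (fun i : Fin 3 => ∑ j : Fin 3, C ((A⁻¹ : GL (Fin 3) k).val i j) * X j)
    (n := 1) (fun i => IsHomogeneous.sum _ _ _ fun j _ => isHomogeneous_C_mul_X _ _)
  simpa [PlaneCurve.transform] using this

lemma eval_transform (A : GL (Fin 3) k) (f : MvPolynomial (Fin 3) k) (v : Fin 3 → k) :
    eval v (transform A f) = eval ((A⁻¹ : GL (Fin 3) k).val *ᵥ v) f := by
  unfold transform
  induction f using MvPolynomial.induction_on with
  | C a => simp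
  | add p q hp hq => rw [map_add, map_add, hp, hq, map_add]
  | mul_X p i hp =>
    rw [map_mul, map_mul, hp, map_mul, aeval_X, eval_X]
    simp [Matrix.mulVec, dotProduct]

lemma pderiv_transform (A : GL (Fin 3) k) (f : MvPolynomial (Fin 3) k) (i : Fin 3) :
    pderiv i (transform A f) =
      ∑ j, transform A (pderiv j f) * C ((A⁻¹ : GL (Fin 3) k).val j i) := by
  unfold transform
  induction f using MvPolynomial.induction_on with
  | C a => simp
  | add p q hp hq => simp only [map_add, hp, hq, add_mul, Finset.sum_add_distrib]
  | mul_X p l hp =>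
    simp only [map_mul, aeval_X, pderiv_mul, hp, map_sum, pderiv_X, map_add,
      add_mul, Finset.sum_add_distrib, Pi.single_apply]
    congr 1
    · rw [Finset.sum_mul]
      exact Finset.sum_congr rfl fun j _ => by ring
    · simp

/-- By the chain rule the gradients at `v` and at `A⁻¹ v` differ by an invertible matrix. This
allows coordinates to be changed freely. -/
lemma IsSingular.of_transform {A : GL (Fin 3) k} {f : MvPolynomial (Fin 3) k}
    (h : IsSingular (transform A f)) : IsSingular f := by
  obtain ⟨v, hv, h0, h1⟩ := h
  refine ⟨(A⁻¹ : GL (Fin 3) k).val *ᵥ v, fun h => hv ?_, by rwa [← eval_transform], ?_⟩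
  · have := congrArg (fun w => A.val *ᵥ w) h
    simpa [Matrix.mulVec_mulVec, ← Units.val_mul] using this
  · have h2 : (fun j => eval ((A⁻¹ : GL (Fin 3) k).val *ᵥ v) (pderiv j f)) ᵥ*
        (A⁻¹ : GL (Fin 3) k).val = 0 := by
      ext i
      have := h1 i
      rw [pderiv_transform] at this
      simpa [eval_transform, Matrix.vecMul, dotProduct] using this
    have h3 := congrArg (fun w => w ᵥ* A.val) h2
    simp only [Matrix.vecMul_vecMul, ← Units.val_mul, inv_mul_cancel, Units.val_one,
      Matrix.vecMul_one, Matrix.zero_vecMul] at h3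
    exact fun i => congrFun h3 i

/-- Evaluating a form at a vertex of the coordinate triangle picks out a coefficient. -/
lemma eval_single_of_isHomogeneous {f : MvPolynomial (Fin 3) k} {n : ℕ} (hf : f.IsHomogeneous n)
    (i : Fin 3) : eval (Pi.single i (1 : k)) f = coeff (Finsupp.single i n) f := by
  classical
  rw [eval_eq']
  have key : ∀ d ∈ f.support, d ≠ Finsupp.single i n →
      coeff d f * ∏ j, (Pi.single i (1 : k) : Fin 3 → k) j ^ d j = 0 := by
    intro d hd hne
    have hdeg : d.degree = n := by
      have := hf (mem_support_iff.1 hd)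
      rwa [Finsupp.degree_eq_weight_one]
    obtain ⟨j, hji, hj⟩ : ∃ j, j ≠ i ∧ d j ≠ 0 := by
      by_contra! hcon
      refine hne ?_
      have : d = Finsupp.single i (d i) := by
        ext j
        by_cases h : j = i
        · simp [h]
        · simp [hcon j h, h]
      rw [this, Finsupp.degree_single] at hdeg
      rw [this, hdeg]
    rw [Finset.prod_eq_zero (Finset.mem_univ j), mul_zero]
    rw [Pi.single_eq_of_ne hji, zero_pow hj]
  by_cases hs : Finsupp.single i n ∈ f.support
  · rw [Finset.sum_eq_single_of_mem _ hs key, Finset.prod_eq_one, mul_one]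
    intro j _
    by_cases h : j = i
    · simp [h]
    · simp [h]
  · rw [Finset.sum_eq_zero fun d hd => key d hd fun h => hs (h ▸ hd), notMem_support_iff.1 hs]

/-- The curve of a non-singular form is smooth at each vertex of the coordinate triangle. -/
lemma exists_coeff_ne_zero_of_not_isSingular {f : MvPolynomial (Fin 3) k} {n : ℕ}
    (hf : f.IsHomogeneous (n + 1)) (hs : ¬ IsSingular f) (i : Fin 3) :
    ∃ j, coeff (Finsupp.single i n + Finsupp.single j 1) f ≠ 0 := by
  by_contra! h
  refine hs ⟨Pi.single i 1, by simp, ?_, fun j => ?_⟩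
  · rw [eval_single_of_isHomogeneous hf, Finsupp.single_add, h]
  · rw [eval_single_of_isHomogeneous (hf.pderiv (i := j)), coeff_pderiv, Nat.add_sub_cancel, h,
      zero_mul]

lemma coeff_transform_of_inv_eq_diagonal {A : GL (Fin 3) k} {e : Fin 3 → k}
    (hA : (A⁻¹ : GL (Fin 3) k).val = diagonal e) (f : MvPolynomial (Fin 3) k) (m : Fin 3 →₀ ℕ) :
    coeff m (transform A f) = coeff m f * ∏ i, e i ^ m i := by
  have h : ∀ i : Fin 3, ∑ j : Fin 3, C ((A⁻¹ : GL (Fin 3) k).val i j) * X j =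
      (C (e i) * X i : MvPolynomial (Fin 3) k) := by
    intro i
    rw [Finset.sum_eq_single i] <;> simp +contextual [hA, eq_comm]
  unfold transform
  simp only [h]
  induction f using MvPolynomial.induction_on' with
  | add p q hp hq => rw [map_add, coeff_add, hp, hq, coeff_add, add_mul]
  | monomial u a =>
    have : (aeval fun i => C (e i) * X i) (monomial u a) =
        monomial u (a * ∏ i, e i ^ u i) := by
      rw [aeval_monomial, monomial_eq, Finsupp.prod_fintype _ _ (by simp),
        Finsupp.prod_fintype _ _ (by simp)]
      simp [mul_pow, Finset.prod_mul_distrib, mul_assoc, MvPolynomial.algebraMap_eq]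
    rw [this, coeff_monomial, coeff_monomial]
    split_ifs with hu
    · rw [hu]
    · simp

/-- All monomials of a form that is semi-invariant under a diagonal matrix have the same weight. -/
lemma prod_pow_eq_of_transform_eq {A : GL (Fin 3) k} {d : Fin 3 → k} (hA : A.val = diagonal d)
    {f : MvPolynomial (Fin 3) k} {c : k} (h : transform A f = C c * f) {m m' : Fin 3 →₀ ℕ}
    (hm : coeff m f ≠ 0) (hm' : coeff m' f ≠ 0) :
    ∏ i, d i ^ m i = ∏ i, d i ^ m' i := by
  have hi : (A⁻¹ : GL (Fin 3) k).val = diagonal d⁻¹ := by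
    rw [Matrix.coe_units_inv, hA]
    refine Matrix.inv_eq_left_inv ?_
    rw [diagonal_mul_diagonal, ← diagonal_one]
    congr 1
    ext i
    refine inv_mul_cancel₀ fun h0 => ?_
    have := (Matrix.isUnit_iff_isUnit_det _).1 A.isUnit
    rw [hA, det_diagonal] at this
    exact this.ne_zero (Finset.prod_eq_zero (Finset.mem_univ i) h0)
  have key : ∀ {l : Fin 3 →₀ ℕ}, coeff l f ≠ 0 → (∏ i, d i ^ l i)⁻¹ = c := by
    intro l hl
    have := congrArg (coeff l) h
    rw [coeff_transform_of_inv_eq_diagonal hi, coeff_C_mul, mul_comm] at this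
    rw [← mul_right_cancel₀ hl this]
    simp
  exact inv_injective ((key hm).trans (key hm').symm)

lemma prod_pow_single_add_single (d : Fin 3 → k) (i j : Fin 3) (n : ℕ) :
    ∏ l, d l ^ ((Finsupp.single i n + Finsupp.single j 1 : Fin 3 →₀ ℕ) l) = d i ^ n * d j := by
  simp only [Finsupp.add_apply, pow_add, Finset.prod_mul_distrib, Finsupp.single_apply]
  simp

end Transform

/-! ### Diagonalizable matrices and the diagonal torus. -/

section Diagonalization

variable {k n : Type*} [Field k] [Fintype n] [DecidableEq n]

lemma exists_diagonal_of_iSup_eigenspace_eq_top {A : Matrix n n k}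
    (h : ⨆ μ, Module.End.eigenspace (Matrix.toLin' A) μ = ⊤) :
    ∃ (P : GL n k) (d : n → k), A * P.val = P.val * diagonal d := by
  set s : Set (n → k) := {v | ∃ μ : k, A *ᵥ v = μ • v} with hs
  have hspan : ⊤ ≤ Submodule.span k s := by
    rw [← h, iSup_le_iff]
    intro μ v hv
    refine Submodule.subset_span ⟨μ, ?_⟩
    simpa using Module.End.mem_eigenspace_iff.1 hv
  let b := Module.Basis.ofSpan hspan
  have : Fintype ((linearIndepOn_empty k id).extend (Set.empty_subset s)) :=
    Module.Basis.fintypeIndexOfRankLtAleph0 b (by simp)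
  let e := b.indexEquiv (Pi.basisFun k n)
  let b' := b.reindex e
  have hb : ∀ i, ∃ μ : k, A *ᵥ b' i = μ • b' i := by
    intro i
    have : b' i ∈ s := by
      rw [Module.Basis.reindex_apply]
      exact Module.Basis.ofSpan_subset hspan ⟨_, rfl⟩
    exact this
  choose d hd using hb
  have hu : IsUnit (Matrix.of fun i j => b' j i) := by
    rw [← Matrix.linearIndependent_cols_iff_isUnit]
    exact b'.linearIndependent
  refine ⟨hu.unit, d, ?_⟩
  ext i j
  rw [mul_diagonal, IsUnit.unit_spec]
  have := congrFun (hd j) i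
  simpa [Matrix.mul_apply, Matrix.mulVec, dotProduct, mul_comm] using this

/-- Over an algebraically closed field of characteristic zero, a matrix with a non-zero scalar
power is diagonalizable. -/
lemma exists_diagonal_of_pow_eq_smul_one [IsAlgClosed k] [CharZero k] {A : Matrix n n k} {N : ℕ}
    (hN : N ≠ 0) {c : k} (hc : c ≠ 0) (h : A ^ N = c • (1 : Matrix n n k)) :
    ∃ (P : GL n k) (d : n → k), A * P.val = P.val * diagonal d := by
  refine exists_diagonal_of_iSup_eigenspace_eq_top (Module.End.IsSemisimple.iSup_eigenspace_eq_top
    (Module.End.isSemisimple_of_squarefree_aeval_eq_zero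
      -- Separable because `N` and `c` are non-zero in `k`.
      (p := Polynomial.X ^ N - Polynomial.C c)
      (Polynomial.separable_X_pow_sub_C c (by exact_mod_cast hN) hc).squarefree ?_))
  have : (Matrix.toLin' A) ^ N = c • 1 := by
    rw [← Matrix.toLin'_pow, h, map_smul, Matrix.toLin'_one]
    rfl
  simp [this, Algebra.smul_def]

/-- Permute the columns of `P`, that is, the eigenvectors. -/
lemma exists_diagonal_comp_perm {A : Matrix n n k} {P : GL n k} {d : n → k}
    (h : A * P.val = P.val * diagonal d) (σ : Equiv.Perm n) :
    ∃ P' : GL n k, A * P'.val = P'.val * diagonal (d ∘ σ) := by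
  have hu : IsUnit (P.val.submatrix (Equiv.refl n) σ) :=
    (Matrix.isUnit_submatrix_equiv _ _).2 P.isUnit
  refine ⟨hu.unit, ?_⟩
  rw [IsUnit.unit_spec]
  ext i j
  have := congrFun (congrFun h i) (σ j)
  rw [mul_diagonal] at this ⊢
  simpa [Matrix.mul_apply] using this

/-- The torus of invertible diagonal matrices. -/
noncomputable def diagonalHom (n k : Type*) [Field k] [Fintype n] [DecidableEq n] :
    (n → kˣ) →* GL n k :=
  (Units.map (Matrix.diagonalRingHom n k).toMonoidHom).comp
    (MulEquiv.piUnits (M := fun _ : n => k)).symm.toMonoidHom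

lemma coe_diagonalHom (d : n → kˣ) : (diagonalHom n k d).val = diagonal fun i => (d i : k) := rfl

lemma diagonalHom_injective : Function.Injective (diagonalHom n k) := by
  intro d d' h
  have := congrArg Units.val h
  rw [coe_diagonalHom, coe_diagonalHom] at this
  ext i
  exact congrFun (diagonal_injective this) i

lemma exists_diagonalHom_of_apply_eq_zero {B : GL n k} (h : ∀ i j, i ≠ j → B.val i j = 0) :
    ∃ d, diagonalHom n k d = B := by
  have hB : B.val = diagonal fun i => B.val i i := by
    ext i j
    by_cases hij : i = j
    · simp [hij]
    · rw [diagonal_apply_ne _ hij, h i j hij]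
  have hne : ∀ i, B.val i i ≠ 0 := by
    intro i h0
    have := (Matrix.isUnit_iff_isUnit_det _).1 B.isUnit
    rw [hB, det_diagonal] at this
    exact this.ne_zero (Finset.prod_eq_zero (Finset.mem_univ i) h0)
  exact ⟨fun i => Units.mk0 _ (hne i), Units.ext (by rw [coe_diagonalHom]; exact hB.symm)⟩

end Diagonalization

/-! ### Counting in finite groups. -/

section Group

lemma card_le_card_comap {G G' : Type*} [Group G] [Group G'] {f : G →* G'}
    (hf : Function.Injective f) {H S : Subgroup G'} (hS : Finite S) (hHS : H ≤ S)
    (hH : H ≤ f.range) : Nat.card H ≤ Nat.card (S.comap f) := by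
  have h1 : (H.comap f).map f = H := Subgroup.map_comap_eq_self hH
  have : Finite (S.comap f) := Nat.finite_of_card_ne_zero fun h0 => by
    have := Subgroup.card_comap_dvd_of_injective S f hf
    rw [h0, zero_dvd_iff] at this
    exact Nat.card_pos.ne' this
  rw [← h1, Subgroup.card_map_of_injective hf]
  exact Subgroup.card_le_of_le (Subgroup.comap_mono hHS)

/-- If every element of a finite group conjugates `g` into `{g, c * g}`, then half of the elements
centralize `g`. -/
lemma card_le_two_mul_card_of_comm {G : Type*} [Group G] {S : Subgroup G} {g c : G}
    (hc : ∀ h ∈ S, h * g * h⁻¹ = g ∨ h * g * h⁻¹ = c * g)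
    (hcc : ∀ h ∈ S, h * (c * g) * h⁻¹ = c * (h * g * h⁻¹)) (hc2 : c * c = 1) :
    Nat.card S ≤ 2 * Nat.card (S ⊓ Subgroup.centralizer {g} : Subgroup G) := by
  set H : Subgroup S := (Subgroup.centralizer {g}).subgroupOf S with hH
  have hmem : ∀ h : S, h ∈ H ↔ (h : G) * g * (h : G)⁻¹ = g := by
    intro h
    rw [hH, Subgroup.mem_subgroupOf, Subgroup.mem_centralizer_singleton_iff,
      mul_inv_eq_iff_eq_mul]
  have hindex : H.index ∣ 2 := by
    by_cases htop : H = ⊤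
    · simp [htop]
    obtain ⟨a, ha⟩ : ∃ a, a ∉ H := by
      by_contra! hcon
      exact htop (eq_top_iff.2 fun x _ => hcon x)
    refine dvd_of_eq (Subgroup.index_eq_two_iff.2 ⟨a, fun b => ?_⟩)
    have ha1 : (a : G) * g * (a : G)⁻¹ = c * g :=
      (hc a a.2).resolve_left fun h => ha ((hmem a).2 h)
    have hcg : c * g ≠ g := fun h => ha ((hmem a).2 (ha1.trans h))
    have hba : ((b * a : S) : G) * g * ((b * a : S) : G)⁻¹ = c * (b * g * (b : G)⁻¹) := by
      rw [← hcc b b.2, ← ha1]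
      push_cast
      group
    rw [hmem, hmem, hba]
    rcases hc b b.2 with h | h
    · rw [h]; simp [hcg]
    · rw [h, ← mul_assoc, hc2, one_mul]; simp [hcg]
  have hcard : Nat.card (S ⊓ Subgroup.centralizer {g} : Subgroup G) = Nat.card H := by
    rw [← Subgroup.card_map_of_injective S.subtype_injective (K := H), hH,
      Subgroup.subgroupOf_map_subtype, inf_comm]
  rw [hcard, ← Subgroup.card_mul_index H, mul_comm]
  exact Nat.mul_le_mul_right _ (Nat.le_of_dvd two_pos hindex)

/-- A finite group with two jointly injective characters, the first one of exponent dividing `n`,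
contains elements killed by the first one on which the second one has large order. -/
lemma exists_eq_one_and_le_orderOf {k H : Type*} [Field k] [Group H] [Finite H] (φ χ : H →* kˣ)
    (hinj : ∀ h, φ h = 1 → χ h = 1 → h = 1) {n m : ℕ} (hn : n ≠ 0) (hφ : ∀ h, φ h ^ n = 1)
    (hcard : n * m ≤ Nat.card H) : ∃ h, φ h = 1 ∧ m ≤ orderOf (χ h) := by
  have hrange : Nat.card φ.range ≤ n := by
    have : NeZero n := ⟨hn⟩
    have hle : φ.range ≤ rootsOfUnity n k := by
      rintro _ ⟨h, rfl⟩
      exact hφ h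
    refine (Subgroup.card_le_of_le hle).trans ?_
    exact card_rootsOfUnity k n
  have hker : m ≤ Nat.card φ.ker := by
    have h1 := Subgroup.card_mul_index φ.ker
    rw [Subgroup.index_ker] at h1
    have h2 : n * m ≤ n * Nat.card φ.ker := by
      rw [mul_comm n (Nat.card _)]
      exact hcard.trans (h1 ▸ Nat.mul_le_mul_left _ hrange)
    exact Nat.le_of_mul_le_mul_left h2 (Nat.pos_of_ne_zero hn)
  have hχ : Function.Injective (χ.comp φ.ker.subtype) := by
    rw [injective_iff_map_eq_one]
    intro a ha
    exact Subtype.ext (hinj a a.2 ha)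
  -- On the kernel of `φ` the character `χ` is injective, and finite subgroups of `kˣ` are cyclic.
  have hcyc : IsCyclic φ.ker :=
    isCyclic_of_injective_ringHom ((Units.coeHom k).comp (χ.comp φ.ker.subtype))
      (Units.val_injective.comp hχ)
  obtain ⟨g, hg⟩ := IsCyclic.exists_ofOrder_eq_natCard (α := φ.ker)
  refine ⟨g, g.2, ?_⟩
  have := orderOf_injective _ hχ g
  simp only [MonoidHom.comp_apply, Subgroup.subtype_apply] at this
  rwa [this, hg]

end Group

/-! ### The arithmetic of vertex weights. -/

section Weights

/-- On three points every orbit enters a cycle after at most two steps, and cycle lengths divide 6.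
-/
lemma iterate_eight_eq_iterate_two (j : Fin 3 → Fin 3) (i : Fin 3) :
    j (j (j (j (j (j (j (j i))))))) = j (j i) := by
  revert i
  revert j
  decide

/-- Iterating `u (j i) = s - 7 u i` gives `u (j^n i) = (-7)^n u i + ((1 - (-7)^n) / 8) s`. Comparing
`n = 8` with `n = 2` gives the constants `7^8 - 7^2` and `(7^8 - 7^2) / 8`. -/
lemma smul_eq_smul_of_smul_add_eq {M : Type*} [AddCommGroup M] {u : Fin 3 → M}
    {j : Fin 3 → Fin 3} {s : M} (h : ∀ i, (7 : ℤ) • u i + u (j i) = s) (i : Fin 3) :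
    (5764752 : ℕ) • u i = (720594 : ℕ) • s := by
  have h' : ∀ i, u (j i) = s - (7 : ℤ) • u i := fun i => eq_sub_of_add_eq' (h i)
  have h8 := congrArg u (iterate_eight_eq_iterate_two j i)
  simp only [h'] at h8
  rw [← sub_eq_zero] at h8 ⊢
  rw [← h8]
  module

lemma pow_eq_pow_of_pow_mul_eq {G : Type*} [CommGroup G] {r : Fin 3 → G} {j : Fin 3 → Fin 3}
    (h : ∀ i l, r i ^ 7 * r (j i) = r l ^ 7 * r (j l)) (i l : Fin 3) :
    r i ^ 5764752 = r l ^ 5764752 := by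
  have key := smul_eq_smul_of_smul_add_eq (u := fun i => Additive.ofMul (r i)) (j := j)
    (s := Additive.ofMul (r 0 ^ 7 * r (j 0))) (fun i => by
      rw [h 0 i]
      simp only [ofMul_mul, ofMul_pow]
      norm_cast)
  exact Additive.ofMul.injective ((key i).trans (key l).symm)

/-- If the monomials `x_i ^ 7 * x_(j i)` all have the same weight under a diagonal matrix whose
entries are `N`-th roots of unity, then its ratios of eigenvalues have small order. -/
lemma pow_gcd_eq_pow_gcd_of_pow_mul_eq {G : Type*} [CommGroup G] {r : Fin 3 → G}
    {j : Fin 3 → Fin 3} (h : ∀ i l, r i ^ 7 * r (j i) = r l ^ 7 * r (j l)) {N : ℕ}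
    (hr : ∀ i l, r i ^ N = r l ^ N) (i l : Fin 3) :
    r i ^ Nat.gcd 5764752 N = r l ^ Nat.gcd 5764752 N := by
  rw [← div_eq_one, ← div_pow]
  exact pow_gcd_eq_one.2 ⟨by rw [div_pow, div_eq_one, pow_eq_pow_of_pow_mul_eq h i l],
    by rw [div_pow, div_eq_one, hr i l]⟩

end Weights

/-! ### Lifting relations from the projective group to matrices. -/

section ProjectiveGroup

variable {k : Type*} [Field k]

lemma exists_pow_eq_smul_one_of_mk_pow_eq_one {n : Type*} [Fintype n] [DecidableEq n] {A : GL n k}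
    {N : ℕ} (h : ProjGenLinGroup.mk A ^ N = 1) :
    ∃ c : k, c ≠ 0 ∧ A.val ^ N = c • (1 : Matrix n n k) := by
  rw [← map_pow, ProjGenLinGroup.mk_eq_one, GeneralLinearGroup.center_eq_range_scalar] at h
  obtain ⟨u, hu⟩ := h
  refine ⟨u, u.ne_zero, ?_⟩
  rw [← Units.val_pow_eq_pow_val, ← hu, GeneralLinearGroup.coe_scalar, scalar_apply,
    smul_one_eq_diagonal]

lemma smul_eq_smul_of_mk_commute {n : Type*} [Fintype n] [DecidableEq n] {A B : GL n k}
    (h : ProjGenLinGroup.mk A * ProjGenLinGroup.mk B =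
      ProjGenLinGroup.mk B * ProjGenLinGroup.mk A) :
    ∃ u : kˣ, A.val * B.val = (u : k) • (B.val * A.val) := by
  rw [← map_mul, ← map_mul, eq_comm, ProjGenLinGroup.mk_eq_mk_iff] at h
  obtain ⟨u, hu⟩ := h
  refine ⟨u, ?_⟩
  rw [← Units.val_mul, ← Units.val_mul, ← hu, Units.val_mul, GeneralLinearGroup.coe_scalar,
    scalar_apply, ← smul_one_eq_diagonal, mul_smul_comm, mul_one]

lemma pow_eq_of_pow_eq_smul_one {n : Type*} [Fintype n] [DecidableEq n] {A : Matrix n n k}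
    {P : GL n k} {d : n → k} (h : A * P.val = P.val * diagonal d) {N : ℕ} {c : k}
    (hA : A ^ N = c • (1 : Matrix n n k)) (i : n) : d i ^ N = c := by
  have h1 : A ^ N * P.val = P.val * diagonal (d ^ N) := by
    rw [← diagonal_pow]
    exact ((show SemiconjBy P.val (diagonal d) A from h.symm).pow_right N).eq.symm
  have h2 : P.val * diagonal (d ^ N) = P.val * diagonal (fun _ => c) := by
    rw [← h1, hA, ← smul_one_eq_diagonal]
    simp
  exact congrFun (diagonal_injective (P.isUnit.mul_left_cancel h2)) i

lemma apply_eq_of_mk_ne_one {n : Type*} [Fintype n] [DecidableEq n] {A : GL n k}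
    {P : GL n k} {d : n → k} (h : A.val * P.val = P.val * diagonal d)
    (hA : ProjGenLinGroup.mk A ≠ 1) : ∀ c, ∃ i, d i ≠ c := by
  intro c
  by_contra! hd
  refine hA ?_
  rw [ProjGenLinGroup.mk_eq_one, GeneralLinearGroup.mem_center_iff_val_mem_range_scalar]
  refine ⟨c, P.isUnit.mul_right_cancel ?_⟩
  rw [h, scalar_apply, ← smul_one_eq_diagonal, funext hd, ← smul_one_eq_diagonal]
  simp

end ProjectiveGroup

/-! ### Finite 2-groups in `GL(2, k)`. -/

section GLTwo

variable {k : Type*} [Field k] [IsAlgClosed k] [CharZero k]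

/-- A finite 2-group of invertible `2 × 2` matrices has a diagonalizable subgroup of index at
most two. -/
lemma exists_card_le_card_comap_diagonalHom {S : Subgroup (GL (Fin 2) k)} {r : ℕ}
    (hS : Nat.card S = 2 ^ r) :
    ∃ Q : GL (Fin 2) k, 2 ^ r ≤
      2 * Nat.card (S.comap ((MulAut.conj Q).toMonoidHom.comp (diagonalHom (Fin 2) k))) := by
  have hfin : Finite S := Nat.finite_of_card_ne_zero (by simp [hS])
  have hinj : ∀ Q : GL (Fin 2) k,
      Function.Injective ((MulAut.conj Q).toMonoidHom.comp (diagonalHom (Fin 2) k)) :=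
    fun Q => (MulAut.conj Q).injective.comp diagonalHom_injective
  set T := S.map (ProjGenLinGroup.mk (n := Fin 2) (R := k)) with hT
  have hTfin : Finite T := (Set.Finite.image _ (Set.toFinite (S : Set (GL (Fin 2) k)))).to_subtype
  have hTp : IsPGroup 2 T := (IsPGroup.of_card hS).map _
  -- If the projective image is trivial, `S` consists of scalars; otherwise `g` lifts a non-trivial
  -- central element of the image and has distinct eigenvalues, so its centralizer is a torus.
  rcases subsingleton_or_nontrivial T with hTs | hTn
  · refine ⟨1, ?_⟩
    rw [← hS]
    refine (card_le_card_comap (hinj 1) hfin le_rfl fun h hh => ?_).trans (by omega)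
    have h1 : ProjGenLinGroup.mk h = 1 :=
      congrArg Subtype.val (Subsingleton.elim (⟨_, Subgroup.mem_map_of_mem _ hh⟩ : T) 1)
    rw [ProjGenLinGroup.mk_eq_one, GeneralLinearGroup.center_eq_range_scalar] at h1
    obtain ⟨u, rfl⟩ := h1
    exact ⟨fun _ => u, by simp; rfl⟩
  have hcn := hTp.center_nontrivial
  obtain ⟨⟨⟨_, g, hg, rfl⟩, hcen⟩, hne⟩ := exists_ne (1 : Subgroup.center T)
  have hne' : ProjGenLinGroup.mk g ≠ 1 := fun h => hne (Subtype.ext (Subtype.ext h))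
  have hcomm : ∀ h ∈ S, ∃ u : kˣ, h.val * g.val = (u : k) • (g.val * h.val) := by
    intro h hh
    refine smul_eq_smul_of_mk_commute ?_
    exact congrArg Subtype.val
      (Subgroup.mem_center_iff.1 hcen (⟨_, Subgroup.mem_map_of_mem _ hh⟩ : T))
  have hgpow : g.val ^ 2 ^ r = (1 : k) • (1 : Matrix (Fin 2) (Fin 2) k) := by
    have h1 : (⟨g, hg⟩ : S) ^ 2 ^ r = 1 := hS ▸ pow_card_eq_one'
    have h2 : g ^ 2 ^ r = 1 := congrArg Subtype.val h1
    rw [← Units.val_pow_eq_pow_val, h2, one_smul, Units.val_one]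
  obtain ⟨Q, d, hQ⟩ := exists_diagonal_of_pow_eq_smul_one (by simp) one_ne_zero hgpow
  have hd : d 0 ≠ d 1 := by
    intro h01
    obtain ⟨i, hi⟩ := apply_eq_of_mk_ne_one hQ hne' (d 0)
    fin_cases i
    · exact hi rfl
    · exact hi h01.symm
  set c : GL (Fin 2) k := GeneralLinearGroup.scalar (Fin 2) (-1) with hc
  have hcval : c.val = -1 := by
    rw [hc, GeneralLinearGroup.coe_scalar]
    ext i j
    simp [diagonal_apply, Matrix.one_apply]
    split_ifs <;> simp
  have hle := card_le_two_mul_card_of_comm (S := S) (g := g) (c := c) ?_ ?_ ?_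
  · refine ⟨Q, hS ▸ hle.trans (Nat.mul_le_mul_left _
      (card_le_card_comap (hinj Q) hfin inf_le_left fun h hh => ?_))⟩
    have hgh : h * g = g * h := Subgroup.mem_centralizer_singleton_iff.1 hh.2
    have hB : (Q⁻¹ * h * Q).val * diagonal d = diagonal d * (Q⁻¹ * h * Q).val := by
      have hg' : diagonal d = (Q⁻¹ * g * Q).val := by
        rw [mul_assoc, Units.val_mul, Units.val_mul, hQ, ← mul_assoc, ← Units.val_mul,
          inv_mul_cancel, Units.val_one, one_mul]
      rw [hg', ← Units.val_mul, ← Units.val_mul]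
      congr 1
      calc Q⁻¹ * h * Q * (Q⁻¹ * g * Q) = Q⁻¹ * (h * g) * Q := by group
        _ = Q⁻¹ * (g * h) * Q := by rw [hgh]
        _ = _ := by group
    obtain ⟨e, he⟩ := exists_diagonalHom_of_apply_eq_zero (B := Q⁻¹ * h * Q) (fun i j hij => by
      have := congrFun (congrFun hB i) j
      rw [mul_diagonal, diagonal_mul, mul_comm, ← sub_eq_zero, ← sub_mul] at this
      refine (mul_eq_zero.1 this).resolve_left (sub_ne_zero.2 ?_)
      fin_cases i <;> fin_cases j
      · exact absurd rfl hij
      · exact hd.symm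
      · exact hd
      · exact absurd rfl hij)
    refine ⟨e, ?_⟩
    simp only [MonoidHom.comp_apply, he]
    simp [MulAut.conj_apply, mul_assoc]
  · intro h hh
    -- Determinants of `2 × 2` matrices force `u ^ 2 = 1`, so conjugation sends `g` to `g` or `-g`.
    obtain ⟨u, hu⟩ := hcomm h hh
    have hdet := congrArg Matrix.det hu
    rw [det_smul, det_mul, det_mul, Fintype.card_fin, mul_comm g.val.det] at hdet
    have hne0 : h.val.det * g.val.det ≠ 0 := by
      rw [← det_mul, ← Units.val_mul]
      exact ((Matrix.isUnit_iff_isUnit_det _).1 (h * g).isUnit).ne_zero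
    have hu2 : (u : k) ^ 2 = 1 := (mul_right_cancel₀ hne0 ((one_mul _).trans hdet)).symm
    rcases mul_self_eq_one_iff.1 ((sq _).symm.trans hu2) with h1 | h1
    · left
      rw [mul_inv_eq_iff_eq_mul]
      exact Units.ext (by rw [Units.val_mul, hu, h1, one_smul, Units.val_mul])
    · right
      rw [mul_inv_eq_iff_eq_mul]
      exact Units.ext (by
        rw [Units.val_mul, hu, h1, Units.val_mul, Units.val_mul, hcval, neg_smul, one_smul]
        simp)
  · intro h _
    have := GeneralLinearGroup.scalar_commute (n := Fin 2) (-1 : kˣ) h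
    rw [← hc] at this
    rw [← mul_assoc, ← this]
    group
  · rw [hc, ← map_mul]
    simp

end GLTwo

/-! ### The embedding of `GL(2, k)` as a block. -/

section Block

variable {k : Type*} [Field k]

/-- The block matrix with blocks `M` and `1`. -/
def blockMatrix (M : Matrix (Fin 2) (Fin 2) k) : Matrix (Fin 3) (Fin 3) k :=
  !![M 0 0, M 0 1, 0; M 1 0, M 1 1, 0; 0, 0, 1]

lemma blockMatrix_one : blockMatrix (1 : Matrix (Fin 2) (Fin 2) k) = 1 := by
  ext i j
  fin_cases i <;> fin_cases j <;> simp [blockMatrix]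

lemma blockMatrix_mul (M N : Matrix (Fin 2) (Fin 2) k) :
    blockMatrix (M * N) = blockMatrix M * blockMatrix N := by
  ext i j
  fin_cases i <;> fin_cases j <;>
    simp [blockMatrix, Matrix.mul_apply, Fin.sum_univ_succ]

/-- The embedding of `GL(2, k)` in `GL(3, k)` as the stabilizer of a line and a vector. -/
def blockHom (k : Type*) [Field k] : GL (Fin 2) k →* GL (Fin 3) k :=
  Units.map ⟨⟨blockMatrix, blockMatrix_one⟩, blockMatrix_mul⟩

lemma coe_blockHom (B : GL (Fin 2) k) : (blockHom k B).val = blockMatrix B.val := rfl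

/-- The corner entry 1 forces a scalar block matrix to be the identity. -/
lemma mk_comp_blockHom_injective (P : GL (Fin 3) k) : Function.Injective
    (ProjGenLinGroup.mk.comp ((MulAut.conj P).toMonoidHom.comp (blockHom k))) := by
  rw [injective_iff_map_eq_one]
  intro B hB
  have h1 : ProjGenLinGroup.mk (blockHom k B) = 1 := by
    simpa [MulAut.conj_apply, mul_inv_eq_one] using hB
  rw [ProjGenLinGroup.mk_eq_one, GeneralLinearGroup.mem_center_iff_val_mem_range_scalar] at h1
  obtain ⟨c, hc⟩ := h1
  rw [coe_blockHom] at hc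
  have h := fun i j => congrFun (congrFun hc i) j
  have h22 := h 2 2
  have h00 := h 0 0
  have h01 := h 0 1
  have h10 := h 1 0
  have h11 := h 1 1
  simp [blockMatrix] at h22 h00 h01 h10 h11
  refine Units.ext ?_
  ext i j
  fin_cases i <;> fin_cases j <;> simp [← h00, ← h01, ← h10, ← h11, h22]

/-- An invertible matrix commuting with a diagonal matrix with entries `a, a, b`, `a ≠ b`, is
projectively in the image of `GL(2, k)`. -/
lemma exists_mk_blockHom_eq {B : GL (Fin 3) k} {d : Fin 3 → k} (h01 : d 0 = d 1) (h02 : d 2 ≠ d 0)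
    (h : B.val * diagonal d = diagonal d * B.val) :
    ∃ B' : GL (Fin 2) k, ProjGenLinGroup.mk (blockHom k B') = ProjGenLinGroup.mk B := by
  have hent : ∀ i j, d j ≠ d i → B.val i j = 0 := by
    intro i j hij
    have := congrFun (congrFun h i) j
    rw [mul_diagonal, diagonal_mul, mul_comm, ← sub_eq_zero, ← sub_mul] at this
    exact (mul_eq_zero.1 this).resolve_left (sub_ne_zero.2 hij)
  have e02 := hent 0 2 h02
  have e12 := hent 1 2 (h01 ▸ h02)
  have e20 := hent 2 0 h02.symm
  have e21 := hent 2 1 (h01 ▸ h02.symm)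
  set M : Matrix (Fin 2) (Fin 2) k := !![B.val 0 0, B.val 0 1; B.val 1 0, B.val 1 1] with hM
  have hdet : B.val.det = B.val 2 2 * M.det := by
    rw [det_fin_three, hM, det_fin_two_of, e02, e12, e20, e21]
    ring
  have hu := ((Matrix.isUnit_iff_isUnit_det _).1 B.isUnit).ne_zero
  rw [hdet] at hu
  have h22 : B.val 2 2 ≠ 0 := left_ne_zero_of_mul hu
  have hM' : IsUnit ((B.val 2 2)⁻¹ • M) := by
    rw [Matrix.isUnit_iff_isUnit_det, det_smul, isUnit_iff_ne_zero]
    exact mul_ne_zero (pow_ne_zero _ (inv_ne_zero h22)) (right_ne_zero_of_mul hu)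
  refine ⟨hM'.unit, ProjGenLinGroup.mk_eq_mk_iff.2 ⟨Units.mk0 _ h22, Units.ext ?_⟩⟩
  rw [Units.val_mul, coe_blockHom, IsUnit.unit_spec, GeneralLinearGroup.coe_scalar]
  ext i j
  fin_cases i <;> fin_cases j <;>
    simp [blockMatrix, hM, e02, e12, e20, e21, h22, mul_comm]

lemma blockMatrix_diagonal (d : Fin 2 → k) :
    blockMatrix (diagonal d) = diagonal ![d 0, d 1, 1] := by
  ext i j
  fin_cases i <;> fin_cases j <;> simp [blockMatrix]

end Block

/-! ### Finite 2-groups in `PGL(3, k)`. -/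

section TwoGroup

/-- The entries take exactly two values, opposite in sign, so two of the three agree; the odd one is
moved to the last place. -/
lemma exists_perm_of_sq_eq {k : Type*} [Field k] {d : Fin 3 → k} {c : k} (h : ∀ i, d i ^ 2 = c)
    (hne : ∀ c, ∃ i, d i ≠ c) :
    ∃ σ : Equiv.Perm (Fin 3), d (σ 0) = d (σ 1) ∧ d (σ 2) ≠ d (σ 0) := by
  have hor : ∀ i j, d i = d j ∨ d i = - d j := fun i j => sq_eq_sq_iff_eq_or_eq_neg.1
    ((h i).trans (h j).symm)
  by_cases h01 : d 0 = d 1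
  · refine ⟨1, h01, fun h20 => ?_⟩
    obtain ⟨i, hi⟩ := hne (d 0)
    fin_cases i
    · exact hi rfl
    · exact hi h01.symm
    · exact hi h20
  by_cases h02 : d 0 = d 2
  · exact ⟨Equiv.swap 1 2, h02, fun h => h01 h.symm⟩
  · refine ⟨Equiv.swap 0 2, ?_, h02⟩
    have h1 := (hor 0 1).resolve_left h01
    have h2 := (hor 0 2).resolve_left h02
    exact neg_injective (h2.symm.trans h1)

variable {k : Type*} [Field k] [IsAlgClosed k] [CharZero k]

/-- A non-trivial finite 2-group of projectivities of the plane fixes a point and a line not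
through it, and so lifts to `GL(2, k)`. -/
lemma exists_le_range_blockHom {G : Subgroup PGL(3, k)} {r : ℕ} (hG : Nat.card G = 2 ^ (r + 1)) :
    ∃ P : GL (Fin 3) k,
      G ≤ (ProjGenLinGroup.mk.comp ((MulAut.conj P).toMonoidHom.comp (blockHom k))).range := by
  have hfin : Finite G := Nat.finite_of_card_ne_zero (by simp [hG])
  have hp : IsPGroup 2 G := IsPGroup.of_card hG
  have hnt : Nontrivial G := Finite.one_lt_card_iff_nontrivial.1 (by
    rw [hG]
    exact Nat.one_lt_pow (Nat.succ_ne_zero r) one_lt_two)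
  have hcn := hp.center_nontrivial
  have hdvd : 2 ∣ Nat.card (Subgroup.center G) := by
    obtain ⟨n, hn⟩ := (hp.to_subgroup (Subgroup.center G)).exists_card_eq
    rw [hn]
    refine dvd_pow_self 2 fun h0 => ?_
    rw [h0, pow_zero] at hn
    exact (Finite.one_lt_card_iff_nontrivial.2 hcn).ne' hn
  obtain ⟨⟨⟨z, hz⟩, hcen⟩, hord⟩ := exists_prime_orderOf_dvd_card' 2 hdvd
  obtain ⟨A, rfl⟩ := ProjGenLinGroup.mk_surjective z
  have hne : ProjGenLinGroup.mk A ≠ 1 := fun h => by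
    have h1 : (⟨⟨_, hz⟩, hcen⟩ : Subgroup.center G) = 1 := Subtype.ext (Subtype.ext h)
    rw [h1, orderOf_one] at hord
    exact absurd hord (by norm_num)
  have hsq : ProjGenLinGroup.mk A ^ 2 = 1 := by
    have := pow_orderOf_eq_one (⟨⟨_, hz⟩, hcen⟩ : Subgroup.center G)
    rw [hord] at this
    exact congrArg Subtype.val (congrArg Subtype.val this)
  obtain ⟨c, hc0, hc⟩ := exists_pow_eq_smul_one_of_mk_pow_eq_one hsq
  obtain ⟨P₀, d₀, hP₀⟩ := exists_diagonal_of_pow_eq_smul_one two_ne_zero hc0 hc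
  have hd₀ := pow_eq_of_pow_eq_smul_one hP₀ hc
  obtain ⟨σ, h01, h02⟩ := exists_perm_of_sq_eq hd₀ (apply_eq_of_mk_ne_one hP₀ hne)
  obtain ⟨P, hP⟩ := exists_diagonal_comp_perm hP₀ σ
  refine ⟨P, fun g hg => ?_⟩
  obtain ⟨B, rfl⟩ := ProjGenLinGroup.mk_surjective g
  have hcomm : ProjGenLinGroup.mk B * ProjGenLinGroup.mk A =
      ProjGenLinGroup.mk A * ProjGenLinGroup.mk B :=
    congrArg Subtype.val (Subgroup.mem_center_iff.1 hcen (⟨_, hg⟩ : G))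
  obtain ⟨u, hu⟩ := smul_eq_smul_of_mk_commute hcomm
  -- The commutator scalar has cube 1 by determinants and square 1 because `A ^ 2` is scalar, so the
  -- lifts commute exactly.
  have hu3 : (u : k) ^ 3 = 1 := by
    have hdet := congrArg Matrix.det hu
    rw [det_smul, det_mul, det_mul, Fintype.card_fin, mul_comm A.val.det] at hdet
    have hne0 : B.val.det * A.val.det ≠ 0 := by
      rw [← det_mul, ← Units.val_mul]
      exact ((Matrix.isUnit_iff_isUnit_det _).1 (B * A).isUnit).ne_zero
    exact (mul_right_cancel₀ hne0 ((one_mul _).trans hdet)).symm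
  have hu2 : (u : k) ^ 2 = 1 := by
    have h1 : B.val * A.val ^ 2 = (u : k) ^ 2 • (A.val ^ 2 * B.val) := by
      rw [sq A.val, ← mul_assoc, hu, smul_mul_assoc, mul_assoc, hu, mul_smul_comm, smul_smul,
        mul_assoc, sq]
    rw [hc] at h1
    have h2 : (c • B.val) = ((u : k) ^ 2 * c) • B.val := by simpa [smul_smul] using h1
    have h3 := smul_left_injective k B.isUnit.ne_zero h2
    exact (mul_right_cancel₀ hc0 ((one_mul _).trans h3)).symm
  have hu1 : (u : k) = 1 := by
    rw [pow_succ, hu2, one_mul] at hu3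
    exact hu3
  rw [hu1, one_smul] at hu
  have hA' : diagonal (d₀ ∘ σ) = (P⁻¹ * A * P).val := by
    rw [mul_assoc, Units.val_mul, Units.val_mul, hP, ← mul_assoc, ← Units.val_mul,
      inv_mul_cancel, Units.val_one, one_mul]
  have hBA : B * A = A * B := Units.ext hu
  obtain ⟨B', hB'⟩ := exists_mk_blockHom_eq (B := P⁻¹ * B * P) (d := d₀ ∘ σ) h01 h02 (by
    rw [hA', ← Units.val_mul, ← Units.val_mul]
    congr 1
    calc P⁻¹ * B * P * (P⁻¹ * A * P) = P⁻¹ * (B * A) * P := by group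
      _ = P⁻¹ * (A * B) * P := by rw [hBA]
      _ = _ := by group)
  refine ⟨B', ?_⟩
  simp only [MonoidHom.comp_apply, MulEquiv.coe_toMonoidHom, MulAut.conj_apply, map_mul, hB']
  simp only [← map_mul]
  congr 1
  group

/-- The embedding of the two-dimensional torus in `GL(3, k)`. -/
noncomputable def torusHom (k : Type*) [Field k] : (Fin 2 → kˣ) →* GL (Fin 3) k :=
  (blockHom k).comp (diagonalHom (Fin 2) k)

lemma coe_torusHom {k : Type*} [Field k] (d : Fin 2 → kˣ) :
    (torusHom k d).val = diagonal ![(d 0 : k), d 1, 1] := by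
  rw [torusHom, MonoidHom.comp_apply, coe_blockHom, coe_diagonalHom, blockMatrix_diagonal]

/-- A finite 2-group of projectivities of the plane has a diagonalizable subgroup of index at most
two. -/
lemma exists_card_le_card_comap_torusHom {G : Subgroup PGL(3, k)} {r : ℕ}
    (hG : Nat.card G = 2 ^ (r + 1)) :
    ∃ (P : GL (Fin 3) k) (D : Subgroup (Fin 2 → kˣ)), 2 ^ r ≤ Nat.card D ∧
      Nat.card D ∣ 2 ^ (r + 1) ∧ ∀ d ∈ D, ProjGenLinGroup.mk (P * torusHom k d * P⁻¹) ∈ G := by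
  obtain ⟨P, hP⟩ := exists_le_range_blockHom hG
  set Θ := ProjGenLinGroup.mk.comp ((MulAut.conj P).toMonoidHom.comp (blockHom k)) with hΘ
  have hinj : Function.Injective Θ := mk_comp_blockHom_injective P
  have hS : Nat.card (G.comap Θ) = 2 ^ (r + 1) := by
    rw [← hG, ← Subgroup.card_map_of_injective hinj, Subgroup.map_comap_eq_self hP]
  obtain ⟨Q, hQ⟩ := exists_card_le_card_comap_diagonalHom hS
  refine ⟨P * blockHom k Q, (G.comap Θ).comap
    ((MulAut.conj Q).toMonoidHom.comp (diagonalHom (Fin 2) k)), ?_, ?_, fun d hd => ?_⟩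
  · rw [pow_succ'] at hQ
    omega
  · rw [← hS]
    exact Subgroup.card_comap_dvd_of_injective _ _
      ((MulAut.conj Q).injective.comp diagonalHom_injective)
  · convert Subgroup.mem_comap.1 (Subgroup.mem_comap.1 hd) using 1
    simp only [hΘ, MonoidHom.comp_apply, MulEquiv.coe_toMonoidHom, MulAut.conj_apply, map_mul,
      torusHom, map_inv]
    group

end TwoGroup

/-! ### Octics with prescribed symmetries. -/

section Octics

variable {k : Type*} [Field k]

lemma transform_transform_inv_of_conj {f : MvPolynomial (Fin 3) k} {P T : GL (Fin 3) k} {c : k}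
    (h : transform (P * T * P⁻¹) f = C c * f) :
    transform T (transform P⁻¹ f) = C c * transform P⁻¹ f := by
  rw [← transform_C_mul, ← h, ← transform_mul, ← transform_mul]
  congr 1
  group

/-- The weight condition imposed on a diagonal symmetry by the monomials at the vertices. -/
lemma pow_mul_eq_pow_mul_of_transform_eq {f : MvPolynomial (Fin 3) k} {T : GL (Fin 3) k}
    {w : Fin 3 → kˣ} (hT : T.val = diagonal fun i => (w i : k)) {c : k}
    (h : transform T f = C c * f) {n : ℕ} {j : Fin 3 → Fin 3}
    (hj : ∀ i, coeff (Finsupp.single i n + Finsupp.single (j i) 1) f ≠ 0) (i l : Fin 3) :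
    w i ^ n * w (j i) = w l ^ n * w (j l) := by
  have := prod_pow_eq_of_transform_eq hT h (hj i) (hj l)
  rw [prod_pow_single_add_single, prod_pow_single_add_single] at this
  exact_mod_cast this

lemma projEquiv_fermat_of_support [IsAlgClosed k] {f : MvPolynomial (Fin 3) k} {n : ℕ}
    (hn : n ≠ 0) (hs : ∀ m, coeff m f ≠ 0 → ∃ i, m = Finsupp.single i n)
    (hc : ∀ i, coeff (Finsupp.single i n) f ≠ 0) : ProjEquiv f (fermat k n) := by
  have hroot : ∀ i, ∃ e : kˣ, coeff (Finsupp.single i n) f * (e : k) ^ n = 1 := by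
    intro i
    obtain ⟨e, he⟩ := IsAlgClosed.exists_pow_nat_eq (coeff (Finsupp.single i n) f)⁻¹
      (Nat.pos_of_ne_zero hn)
    have he0 : e ≠ 0 := by
      rintro rfl
      rw [zero_pow hn] at he
      exact inv_ne_zero (hc i) he.symm
    exact ⟨Units.mk0 e he0, by rw [Units.val_mk0, he, mul_inv_cancel₀ (hc i)]⟩
  choose e he using hroot
  refine ⟨(diagonalHom (Fin 3) k e)⁻¹, 1, one_ne_zero, ?_⟩
  rw [C_1, one_mul]
  ext m
  rw [coeff_transform_of_inv_eq_diagonal (e := fun i => (e i : k))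
    (by rw [inv_inv, coe_diagonalHom])]
  have hfer : coeff m (fermat k n) = ∑ i, if Finsupp.single i n = m then 1 else 0 := by
    simp only [fermat, coeff_add, coeff_X_pow, Fin.sum_univ_three]
  rw [hfer]
  by_cases hm : ∃ i, m = Finsupp.single i n
  · obtain ⟨i, rfl⟩ := hm
    rw [Finset.prod_eq_single i (by simp +contextual [eq_comm]) (by simp),
      Finsupp.single_eq_same, he]
    simp [Finsupp.single_left_inj hn]
  · have h0 : coeff m f = 0 := by
      by_contra h0
      exact hm (hs m h0)
    rw [h0, zero_mul, eq_comm]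
    exact Finset.sum_eq_zero fun i _ => if_neg fun h => hm ⟨i, h.symm⟩

/-- A plane octic with a cyclic group of projectivities of order five or eleven is singular. -/
lemma isSingular_of_isCyclic [IsAlgClosed k] [CharZero k] {f : MvPolynomial (Fin 3) k}
    (hf : f.IsHomogeneous 8) {G : Subgroup PGL(3, k)} (hG : IsCyclic G)
    (hcard : Nat.card G = 5 ∨ Nat.card G = 11) (hinv : IsInvariant G f) : IsSingular f := by
  by_contra hs
  obtain ⟨⟨g, hg⟩, hord⟩ := IsCyclic.exists_ofOrder_eq_natCard (α := G)
  obtain ⟨A, rfl⟩ := ProjGenLinGroup.mk_surjective g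
  have hN : Nat.card G ≠ 0 := by omega
  have hpow : ProjGenLinGroup.mk A ^ Nat.card G = 1 :=
    congrArg Subtype.val (hord ▸ pow_orderOf_eq_one (⟨_, hg⟩ : G))
  have hne : ProjGenLinGroup.mk A ≠ 1 := fun h => by
    have h1 : (⟨_, hg⟩ : G) = 1 := Subtype.ext h
    rw [h1, orderOf_one] at hord
    omega
  obtain ⟨c, hc0, hc⟩ := exists_pow_eq_smul_one_of_mk_pow_eq_one hpow
  obtain ⟨P, d, hP⟩ := exists_diagonal_of_pow_eq_smul_one hN hc0 hc
  have hd := pow_eq_of_pow_eq_smul_one hP hc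
  have hd0 : ∀ i, d i ≠ 0 := fun i h0 => hc0 (by rw [← hd i, h0, zero_pow hN])
  set w : Fin 3 → kˣ := fun i => Units.mk0 (d i) (hd0 i) with hw
  have hT : (P⁻¹ * A * P).val = diagonal fun i => (w i : k) := by
    rw [mul_assoc, Units.val_mul, Units.val_mul, hP, ← mul_assoc, ← Units.val_mul,
      inv_mul_cancel, Units.val_one, one_mul]
    rfl
  obtain ⟨a, -, ha⟩ := hinv A hg
  have hA : P * (P⁻¹ * A * P) * P⁻¹ = A := by group
  rw [← hA] at ha
  choose j hj using exists_coeff_ne_zero_of_not_isSingular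
    (IsHomogeneous.transform hf P⁻¹) (fun h => hs h.of_transform)
  have hweights := pow_mul_eq_pow_mul_of_transform_eq hT (transform_transform_inv_of_conj ha) hj
  have hwN : ∀ i l, w i ^ Nat.card G = w l ^ Nat.card G := fun i l => Units.ext (by
    rw [Units.val_pow_eq_pow_val, Units.val_pow_eq_pow_val]
    exact (hd i).trans (hd l).symm)
  have hgcd : Nat.gcd 5764752 (Nat.card G) = 1 := by
    rcases hcard with h | h <;> norm_num [h]
  obtain ⟨i, hi⟩ := apply_eq_of_mk_ne_one hP hne (d 0)
  refine hi ?_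
  have := pow_gcd_eq_pow_gcd_of_pow_mul_eq hweights hwN i 0
  rw [hgcd, pow_one, pow_one] at this
  exact congrArg Units.val this

/-- The weights of the coordinates under the two-dimensional torus. -/
def torusWeight (d : Fin 2 → kˣ) : Fin 3 → kˣ := ![d 0, d 1, 1]

lemma coe_torusHom_eq_diagonal_torusWeight (d : Fin 2 → kˣ) :
    (torusHom k d).val = diagonal fun i => (torusWeight d i : k) := by
  rw [coe_torusHom]
  congr 1
  ext i
  fin_cases i <;> rfl

lemma torusWeight_pow (d : Fin 2 → kˣ) (n : ℕ) (i : Fin 3) :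
    torusWeight (d ^ n) i = torusWeight d i ^ n := by
  fin_cases i <;> simp [torusWeight]

lemma torusWeight_castSucc (d : Fin 2 → kˣ) (i : Fin 2) :
    torusWeight d i.castSucc = d i := by
  fin_cases i <;> rfl

/-- Coordinate `i` takes at most `n` values on `D`, so its kernel has at least `m` elements and is
cyclic through the other coordinate. -/
lemma exists_mem_apply_eq_one_and_le_orderOf {D : Subgroup (Fin 2 → kˣ)} [Finite D] {n m : ℕ}
    (hn : n ≠ 0) (hD : ∀ d ∈ D, ∀ i, d i ^ n = 1) (hcard : n * m ≤ Nat.card D) (i : Fin 2) :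
    ∃ d ∈ D, d i = 1 ∧ m ≤ orderOf (d (1 - i)) := by
  obtain ⟨h, h1, h2⟩ := exists_eq_one_and_le_orderOf
    ((Pi.evalMonoidHom (fun _ : Fin 2 => kˣ) i).comp D.subtype)
    ((Pi.evalMonoidHom (fun _ : Fin 2 => kˣ) (1 - i)).comp D.subtype)
    (fun h h1 h2 => Subtype.ext (funext fun l => by
      by_cases hl : l = i
      · rw [hl]; exact h1
      · have : l = 1 - i := by omega
        rw [this]; exact h2))
    hn (fun h => hD h h.2 i) hcard
  exact ⟨h, h.2, h1, h2⟩

lemma neg_one_units_ne_one [CharZero k] : (-1 : kˣ) ≠ 1 := fun h => by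
  have := congrArg Units.val h
  norm_num at this

/-- If the diagonal sign changes preserve the weights of the monomials `x_i ^ 7 * x_(j i)`, then
these monomials are the powers `x_i ^ 8`. -/
lemma eq_self_of_torusWeight_neg_one [CharZero k] {j : Fin 3 → Fin 3}
    (h : ∀ d : Fin 2 → kˣ, d = ![-1, 1] ∨ d = ![1, -1] → ∀ i l,
      torusWeight d i ^ 7 * torusWeight d (j i) = torusWeight d l ^ 7 * torusWeight d (j l))
    (i : Fin 3) : j i = i := by
  have hne := neg_one_units_ne_one (k := k)
  have a01 := h _ (Or.inl rfl) 0 1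
  have a12 := h _ (Or.inl rfl) 1 2
  have b01 := h _ (Or.inr rfl) 0 1
  have b12 := h _ (Or.inr rfl) 1 2
  have h7 : (-1 : kˣ) ^ 7 = -1 := by rw [Odd.neg_one_pow (by decide)]
  have key : j 0 = 0 ∧ j 1 = 1 ∧ j 2 = 2 := by
    clear h
    generalize j 0 = a at a01 b01 ⊢
    generalize j 1 = b at a01 b01 a12 b12 ⊢
    generalize j 2 = c at a12 b12 ⊢
    fin_cases a <;> fin_cases b <;> fin_cases c <;>
      simp [torusWeight, h7, hne, hne.symm] at a01 a12 b01 b12 ⊢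
  fin_cases i
  · exact key.1
  · exact key.2.1
  · exact key.2.2

/-- A smooth plane octic with a group of projectivities of order `2 ^ 7` is projectively equivalent
to the Fermat octic. -/
lemma projEquiv_fermat_of_card_eq [IsAlgClosed k] [CharZero k] {f : MvPolynomial (Fin 3) k}
    (hf : f.IsHomogeneous 8) {G : Subgroup PGL(3, k)} (hG : Nat.card G = 2 ^ 7)
    (hs : ¬ IsSingular f) (hinv : IsInvariant G f) : ProjEquiv f (fermat k 8) := by
  obtain ⟨P, D, hD64, hD128, hDG⟩ := exists_card_le_card_comap_torusHom (r := 6) hG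
  have hfin : Finite D := Nat.finite_of_card_ne_zero (by omega)
  set f' := transform P⁻¹ f
  have hhom : f'.IsHomogeneous 8 := IsHomogeneous.transform hf P⁻¹
  have hsemi : ∀ d ∈ D, ∃ c, transform (torusHom k d) f' = C c * f' := by
    intro d hd
    obtain ⟨c, -, hc⟩ := hinv _ (hDG d hd)
    exact ⟨c, transform_transform_inv_of_conj hc⟩
  choose j hj using exists_coeff_ne_zero_of_not_isSingular hhom (fun h => hs h.of_transform)
  have hweights : ∀ d ∈ D, ∀ i l, torusWeight d i ^ 7 * torusWeight d (j i) =
      torusWeight d l ^ 7 * torusWeight d (j l) := by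
    intro d hd
    obtain ⟨c, hc⟩ := hsemi d hd
    exact pow_mul_eq_pow_mul_of_transform_eq (coe_torusHom_eq_diagonal_torusWeight d) hc hj
  have h16 : ∀ d ∈ D, ∀ i, d i ^ 16 = 1 := by
    intro d hd i
    have hd128 : d ^ 128 = 1 := by
      have h1 : (⟨d, hd⟩ : D) ^ 128 = 1 :=
        orderOf_dvd_iff_pow_eq_one.1 ((orderOf_dvd_natCard _).trans hD128)
      exact congrArg Subtype.val h1
    have h2 := pow_gcd_eq_pow_gcd_of_pow_mul_eq (hweights d hd) (N := 128) (fun i l => by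
      rw [← torusWeight_pow, ← torusWeight_pow, hd128]
      fin_cases i <;> fin_cases l <;> rfl) i.castSucc 2
    -- The 2-part of `7^8 - 7^2` is `2^4`.
    have h3 : Nat.gcd 5764752 128 = 16 := by norm_num
    rw [h3, torusWeight_castSucc] at h2
    exact h2.trans (one_pow _)
  have hsign : ∀ i : Fin 2, ∃ d ∈ D, d i = 1 ∧ d (1 - i) = -1 := by
    intro i
    obtain ⟨d, hd, h1, h4⟩ := exists_mem_apply_eq_one_and_le_orderOf (n := 16) (m := 4)
      (by norm_num) h16 (by omega) i
    set y := d (1 - i) with hy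
    have hdvd : orderOf y ∣ 2 ^ 4 := orderOf_dvd_of_pow_eq_one (h16 d hd _)
    obtain ⟨a, ha, hoy⟩ := (Nat.dvd_prime_pow Nat.prime_two).1 hdvd
    obtain ⟨b, rfl⟩ : ∃ b, a = b + 1 := Nat.exists_eq_succ_of_ne_zero (by
      rintro rfl
      omega)
    -- As `y` has order `2 ^ (b + 1)`, its power `y ^ 2 ^ b` has order two, hence is `-1`.
    refine ⟨d ^ 2 ^ b, D.pow_mem hd _, by rw [Pi.pow_apply, h1, one_pow], ?_⟩
    rw [Pi.pow_apply, ← hy]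
    have hsq : (y ^ 2 ^ b) * (y ^ 2 ^ b) = 1 := by
      rw [← sq, ← pow_mul, ← pow_succ, ← hoy, pow_orderOf_eq_one]
    have hne : y ^ 2 ^ b ≠ 1 := fun h => by
      have h5 := Nat.le_of_dvd (by positivity) (orderOf_dvd_of_pow_eq_one h)
      rw [hoy] at h5
      exact absurd h5 (not_le.2 (Nat.pow_lt_pow_right one_lt_two (Nat.lt_succ_self b)))
    refine Units.ext ((mul_self_eq_one_iff.1 ?_).resolve_left fun h => hne (Units.ext h))
    exact congrArg Units.val hsq
  have hjid : ∀ i, j i = i := by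
    refine eq_self_of_torusWeight_neg_one fun d hd => hweights d ?_
    rcases hd with rfl | rfl
    · obtain ⟨e, he, h1, h2⟩ := hsign 1
      convert he
      ext i
      fin_cases i
      · exact congrArg Units.val h2.symm
      · exact congrArg Units.val h1.symm
    · obtain ⟨e, he, h1, h2⟩ := hsign 0
      convert he
      ext i
      fin_cases i
      · exact congrArg Units.val h1.symm
      · exact congrArg Units.val h2.symm
  have hvertex : ∀ i, coeff (Finsupp.single i 8) f' ≠ 0 := by
    intro i
    have := hj i
    rwa [hjid i, ← Finsupp.single_add] at this
  have h8 : ∀ d ∈ D, ∀ i, d i ^ 8 = 1 := by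
    intro d hd i
    have := hweights d hd i.castSucc 2
    rw [hjid, hjid, ← pow_succ, ← pow_succ, torusWeight_castSucc] at this
    exact this.trans (one_pow _)
  have hdvd : ∀ m, coeff m f' ≠ 0 → ∀ i : Fin 2, 8 ∣ m (1 - i : Fin 2).castSucc := by
    intro m hm i
    -- Since `8 * 8 ≤ |D|`, some `d` has order exactly 8 in one coordinate and is 1 in the other;
    -- comparing `m` with `x_2 ^ 8`, of weight 1, gives the divisibility.
    obtain ⟨d, hd, h1, h2⟩ := exists_mem_apply_eq_one_and_le_orderOf (n := 8) (m := 8)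
      (by norm_num) h8 (by omega) i
    have hord : orderOf (d (1 - i)) = 8 :=
      le_antisymm (Nat.le_of_dvd (by norm_num) (orderOf_dvd_of_pow_eq_one (h8 d hd _))) h2
    rw [← hord, orderOf_dvd_iff_pow_eq_one]
    obtain ⟨c, hc⟩ := hsemi d hd
    have h3 := prod_pow_eq_of_transform_eq (coe_torusHom_eq_diagonal_torusWeight d) hc hm
      (hvertex 2)
    refine Units.ext ?_
    fin_cases i <;> simp [Fin.prod_univ_three, torusWeight] at h1 h3 ⊢ <;> simpa [h1] using h3
  have hproj : ProjEquiv f' (fermat k 8) := by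
    refine projEquiv_fermat_of_support (by norm_num) (fun m hm => ?_) hvertex
    have hsum : m 0 + m 1 + m 2 = 8 := by
      rw [← Fin.sum_univ_three (fun i => m i), ← Finsupp.degree_eq_sum,
        Finsupp.degree_eq_weight_one]
      exact hhom hm
    have h0 : 8 ∣ m 0 := hdvd m hm 1
    have h1 : 8 ∣ m 1 := hdvd m hm 0
    have hcases : (m 0 = 8 ∧ m 1 = 0 ∧ m 2 = 0) ∨ (m 0 = 0 ∧ m 1 = 8 ∧ m 2 = 0) ∨
        (m 0 = 0 ∧ m 1 = 0 ∧ m 2 = 8) := by omega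
    rcases hcases with h | h | h
    · refine ⟨0, Finsupp.ext fun i => ?_⟩
      fin_cases i <;> simp [h]
    · refine ⟨1, Finsupp.ext fun i => ?_⟩
      fin_cases i <;> simp [h]
    · refine ⟨2, Finsupp.ext fun i => ?_⟩
      fin_cases i <;> simp [h]
  obtain ⟨A, c, hc, hA⟩ := hproj
  exact ⟨A * P⁻¹, c, hc, by rw [transform_mul, hA]⟩

end Octics

end PlaneCurve

theorem proposition3p2 {k : Type*} [Field k] [IsAlgClosed k] [CharZero k]
    (f : MvPolynomial (Fin 3) k) (hf : f.IsHomogeneous 8) :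
    (∀ G : Subgroup (Matrix.ProjGenLinGroup (Fin 3) k),
      IsCyclic G → (Nat.card G = 5 ∨ Nat.card G = 11) →
        PlaneCurve.IsInvariant G f → PlaneCurve.IsSingular f) ∧
    (∀ G : Subgroup (Matrix.ProjGenLinGroup (Fin 3) k),
      Nat.card G = 2 ^ 7 → ¬ PlaneCurve.IsSingular f → PlaneCurve.IsInvariant G f →
        PlaneCurve.ProjEquiv f (PlaneCurve.fermat k 8)) :=
  ⟨fun _ hG hcard hinv => PlaneCurve.isSingular_of_isCyclic hf hG hcard hinv,
    fun _ hG hs hinv => PlaneCurve.projEquiv_fermat_of_card_eq hf hG hs hinv⟩
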